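/- Let $G=(X\cup Y,E)$ be a nonempty finite simple bipartite graph with parts $X$ and $Y$, without isolated vertices and such that no connected component of $G$ is Eulerian (a graph is Eulerian if it has a closed walk traversing every edge exactly once). Assume that either every vertex in $Y$ has even degree, or some connected component of $G$ contains at least one odd-degree vertex in $X$ and at least one odd-degree vertex in $Y$. For $\mu\in\{1,2\}$, call an integer $j$ a $\mu$-label if $j\equiv\mu\pmod 3$. Let $L$ be a set of integers consisting of exactly $l_1$ $1$-labels and $l_2$ $2$-labels, where $l_1+l_2=|E|$ and $|l_1-l_2|\le 2$. For a bijection $f:E\to L$ and a vertex $v$, let $\sigma_f(v)$ be the sum of $f(e)$ over all edges $e$ incident to $v$, and let $l_{\mu,v}$ be the number of edges incident to $v$ whose label under $f$ is a $\mu$-label. Then there is a bijection $f:E\to L$ such that all of the following hold. (i) For each $x\in X$, $\sigma_f(x)\equiv 1$ or $2\pmod 3$. (ii) If every vertex in $Y$ has even degree, then $l_{1,y}=l_{2,y}$ for every $y\in Y$ except at most one, and if there is an exceptional vertex $y'$, then $|l_{1,y'}-l_{2,y'}|=2$. If $Y$ contains at least one odd-degree vertex, then $|l_{1,y}-l_{2,y}|\le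 1$ for every $y\in Y$. (iii) Let $W$ be the set of vertices of degree one in $Y$, let $Y_2$ be the set of even-degree vertices in $Y$, and let $Y_3=Y\setminus(W\cup Y_2)$. If $|Y_3|\le 1$, $|Y_2\cup Y_3|\ge \frac{|X\cup Y|}{2}$, and each vertex in $Y_2\cup Y_3$ has degree at least four, then for each $\mu\in\{1,2\}$ there is a vertex $v\in X\cup W$ with $\sigma_f(v)\equiv\mu\pmod 3$. -/

import Mathlib

/-- A (finite) graph is Eulerian if it admits an Euler tour: a closed walk that traverses
every edge exactly once. -/
def IsEulerianGraph {V : Type*} [DecidableEq V] (G : SimpleGraph V) : Prop :=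
  ∃ (v : V) (p : G.Walk v v), p.IsEulerian

/-- The integer `j` is a `μ`-label (or, when `j` is a vertex sum, a `μ`-sum): `j ≡ μ (mod 3)`. -/
def IsMuLabel (μ j : ℤ) : Prop := j ≡ μ [ZMOD 3]

instance (μ j : ℤ) : Decidable (IsMuLabel μ j) :=
  inferInstanceAs (Decidable (j ≡ μ [ZMOD 3]))

/-- `f` is a labeling on `G` with `L`: a one-to-one mapping from the edge set of `G` onto the
integer set `L`. (The values of `f` outside the edge set play no role.) -/
def IsLabeling {V : Type*} (G : SimpleGraph V) (L : Finset ℤ) (f : Sym2 V → ℤ) : Prop :=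
  Set.BijOn f G.edgeSet (L : Set ℤ)

section

variable {V : Type*} [Fintype V] [DecidableEq V] (G : SimpleGraph V) [DecidableRel G.Adj]

/-- The vertex sum of `v`: the sum of the labels of the edges incident to `v`. -/
def vertexSum (f : Sym2 V → ℤ) (v : V) : ℤ := ∑ e ∈ G.incidenceFinset v, f e

/-- The number of edges incident to `v` that are labeled with `μ`-labels. -/
def labelCount (f : Sym2 V → ℤ) (μ : ℤ) (v : V) : ℕ :=
  ((G.incidenceFinset v).filter (fun e => IsMuLabel μ (f e))).card

/-- The pendant (degree one) vertices in `Y`. -/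
def pendantIn (Y : Finset V) : Finset V := Y.filter (fun y => G.degree y = 1)

/-- The even-degree vertices in `Y`. -/
def evenIn (Y : Finset V) : Finset V := Y.filter (fun y => Even (G.degree y))

/-- The vertices in `Y` that are neither pendant nor of even degree. -/
def restIn (Y : Finset V) : Finset V := Y \ (pendantIn G Y ∪ evenIn G Y)

end

/-! Since 2 ≡ -1 (mod 3), replace 1-labels by the sign +1 and 2-labels by -1. The signed sum at `v`
is then congruent to the vertex sum mod 3 and equals the difference of the two label counts. So it
suffices to find signs with total `D = l₁ - l₂`, sums over `X` prime to 3, and sums over `Y` as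
small as required (`IsGoodSigning`); labels are then distributed arbitrarily within each sign class.

To find the signs, join a new vertex `none` to every odd vertex of `Y`, making all of `Y` even. Ask
for sums ±1 at odd vertices, ±2 at even vertices of `X`, and 0 at vertices of `Y`. Deleting the new
edges leaves sums 0 or ±1 on `Y` and total minus the sum at `none`, so that sum is asked to be ±2
exactly when it is even and `|D| = 2`. If `Y` has no odd vertex, one chosen vertex of `Y` plays this
role. Parity and a global change of sign then give total `D`.

Such signs exist (`HasOddVertices.exists_signing`) by repeatedly fusing two edges with a common end
`u` into one edge between their other ends, with their signs tied so that they cancel at `u`, or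
agree there if they are the last pair at a vertex that needs ±2. The obstruction would be a
component reduced to a loop, whose contribution cannot be controlled. Keeping an odd vertex in each
nontrivial component excludes this, and `HasOddVertices.exists_splice` shows that some fusion always
does. The hypotheses on Eulerian components and odd vertices provide this invariant at the start.

For (iii), if all sums over `X` agree mod 3, flipping four edges without changing any sum over `Y`
produces the other residue and keeps the old one somewhere (`IsGoodSigning.exists_swap`). -/

/-! ### Euler's theorem, through a longest trail. -/

theorem SimpleGraph.Connected.isEulerianGraph_of_even_degree {V : Type*} [Fintype V]
    [DecidableEq V] {G : SimpleGraph V} [DecidableRel G.Adj] (hG : G.Connected)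
    (heven : ∀ v, Even (G.degree v)) : IsEulerianGraph G := by
  have := hG.nonempty
  obtain ⟨u, v, p, hp, hmax⟩ := SimpleGraph.Walk.exists_isTrail_forall_isTrail_length_le_length G
  have hcount : ∀ x, (∀ z, G.Adj x z → s(x, z) ∈ p.edges) →
      Even (p.edges.countP fun e => x ∈ e) := by
    intro x hx
    convert heven x
    rw [← Multiset.coe_countP, Multiset.countP_eq_card_filter, ← G.card_incidenceFinset_eq_degree]
    change (hp.edgesFinset.filter (x ∈ ·)).card = _
    congr 1
    ext e
    simp only [Finset.mem_filter, G.mem_incidenceFinset]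
    constructor
    · rintro ⟨h1, h2⟩
      exact ⟨p.edges_subset_edgeSet h1, h2⟩
    · rintro ⟨h1, h2⟩
      obtain ⟨z, rfl⟩ := Sym2.mem_iff_exists.mp h2
      exact ⟨hx z h1, h2⟩
  have huv : u = v := by
    -- A longest trail uses every edge at its start, an even number; an open trail uses an odd
    -- number there.
    by_contra hne
    have hall : ∀ z, G.Adj u z → s(u, z) ∈ p.edges := by
      intro z hz
      by_contra hmem
      have := hmax _ _ (.cons hz.symm p) (hp.cons hz.symm (by rwa [Sym2.eq_swap]))
      simp at this
    have := (hp.even_countP_edges_iff u).mp (hcount u hall) hne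
    exact this.1 rfl
  subst huv
  have hadj : ∀ w ∈ p.support, ∀ z, G.Adj w z → s(w, z) ∈ p.edges := by
    intro w hw z hz
    by_contra hmem
    -- A closed trail can be restarted at `w`, where an unused edge would lengthen it.
    have hrot := hp.rotate (u := w) hw
    have := hmax _ _ (.cons hz.symm (p.rotate w hw)) (hrot.cons hz.symm (by
      rw [Sym2.eq_swap, (p.rotate_edges w hw).mem_iff]
      exact hmem))
    simp at this
  have hsupp : ∀ w, w ∈ p.support := by
    intro w
    obtain ⟨q⟩ := hG.preconnected u w
    have : ∀ {a b : V} (q : G.Walk a b), a ∈ p.support → b ∈ p.support := by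
      intro a b q
      induction q with
      | nil => exact id
      | cons h _ ih => exact fun ha => ih (p.snd_mem_support_of_mem_edges (hadj _ ha _ h))
    exact this q p.start_mem_support
  refine ⟨u, p, hp.isEulerian_of_forall_mem ?_⟩
  intro e
  induction e with
  | h a b => exact fun h => hadj a (hsupp a) b h

theorem exists_odd_degree_mem_supp {V : Type*} [Fintype V] [DecidableEq V] (G : SimpleGraph V)
    [DecidableRel G.Adj] (C : G.ConnectedComponent) (hC : ¬ IsEulerianGraph C.toSimpleGraph) :
    ∃ v ∈ C.supp, Odd (G.degree v) := by
  classical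
  by_contra! hno
  apply hC
  have hconn := C.connected_toSimpleGraph
  have : Fintype C := Fintype.ofFinite _
  have : DecidableRel C.toSimpleGraph.Adj := Classical.decRel _
  convert SimpleGraph.Connected.isEulerianGraph_of_even_degree hconn ?_
  intro v
  have := Nat.not_odd_iff_even.mp (hno v v.2)
  convert this using 1
  refine Finset.card_bij (fun a _ => a.1) ?_ ?_ ?_
  · intro a ha
    rw [SimpleGraph.mem_neighborFinset] at ha ⊢
    exact ha
  · intro a _ b _ h
    exact Subtype.ext h
  · intro b hb
    have hb' : G.Adj v b := by simpa using hb
    refine ⟨⟨b, C.mem_supp_of_adj_mem_supp v.2 hb'⟩, ?_, rfl⟩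
    rw [SimpleGraph.mem_neighborFinset]
    exact hb'

/-! ### Fusing edges of a multigraph. -/

section Multigraph

variable {E V M : Type*} [DecidableEq E] [DecidableEq V]

/-- The sum over the flags (half-edges) at `v` of `c`, in the multigraph with edge set `A` in
which the edge `x` joins `ends x false` and `ends x true`. -/
def flagSum [AddCommMonoid M] (A : Finset E) (ends : E → Bool → V) (c : E → Bool → M) (v : V) :
    M :=
  ∑ x ∈ A, ∑ k, if ends x k = v then c x k else 0

/-- The degree of `v` in a multigraph. -/
def flagDegree (A : Finset E) (ends : E → Bool → V) (v : V) : ℕ :=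
  flagSum A ends (fun _ _ => 1) v

/-- The vertex set `S` is a union of components of a multigraph. -/
def IsFlagClosed (A : Finset E) (ends : E → Bool → V) (S : Set V) : Prop :=
  ∀ x ∈ A, ∀ k, ends x k ∈ S ↔ ends x (!k) ∈ S

/-- Every nontrivial component of a multigraph has a vertex of odd degree. -/
def HasOddVertices (A : Finset E) (ends : E → Bool → V) : Prop :=
  ∀ S : Set V, IsFlagClosed A ends S → (∃ v ∈ S, 0 < flagDegree A ends v) →
    ∃ v ∈ S, Odd (flagDegree A ends v)

/-- Replace the value of `g` at the flag `(e, i)`. -/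
def splice {α : Type*} (g : E → Bool → α) (e : E) (i : Bool) (a : α) : E → Bool → α :=
  fun x k => if x = e ∧ k = i then a else g x k

theorem splice_self {α : Type*} (g : E → Bool → α) (e : E) (i : Bool) (a : α) :
    splice g e i a e i = a := by
  simp [splice]

theorem splice_not {α : Type*} (g : E → Bool → α) (e : E) (i : Bool) (a : α) :
    splice g e i a e (!i) = g e (!i) := by
  simp [splice]

theorem splice_of_ne {α : Type*} (g : E → Bool → α) {e x : E} (h : x ≠ e) (i k : Bool) (a : α) :
    splice g e i a x k = g x k := by
  simp [splice, h]

theorem sum_bool_eq_add_not [AddCommMonoid M] (g : Bool → M) (i : Bool) :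
    ∑ k, g k = g i + g (!i) := by
  cases i <;> simp [add_comm]

/-- Fusing the edges `e` and `f` at a common end only affects the flags at that end. -/
theorem flagSum_eq_splice_add [AddCommMonoid M] {A : Finset E} {ends : E → Bool → V} {e f : E}
    (he : e ∈ A) (hf : f ∈ A) (hef : e ≠ f) {i j : Bool} (hu : ends e i = ends f j)
    (c : E → Bool → M) (v : V) :
    flagSum A ends c v =
      flagSum (A.erase f) (splice ends e i (ends f (!j))) (splice c e i (c f (!j))) v +
        if ends e i = v then c e i + c f j else 0 := by
  have he' : e ∈ A.erase f := Finset.mem_erase.mpr ⟨hef, he⟩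
  unfold flagSum
  rw [← Finset.add_sum_erase A _ hf, ← Finset.add_sum_erase _ _ he',
    ← Finset.add_sum_erase (A.erase f) _ he']
  have hrest : ∀ x ∈ (A.erase f).erase e,
      (∑ k, if splice ends e i (ends f (!j)) x k = v then splice c e i (c f (!j)) x k else 0) =
        ∑ k, if ends x k = v then c x k else 0 := by
    intro x hx
    have hxe := (Finset.mem_erase.mp hx).1
    simp only [splice_of_ne _ hxe]
  rw [Finset.sum_congr rfl hrest,
    sum_bool_eq_add_not (fun k => if ends e k = v then c e k else 0) i,
    sum_bool_eq_add_not (fun k => if ends f k = v then c f k else 0) j,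
    sum_bool_eq_add_not _ i]
  simp only [splice_self, splice_not, ← hu]
  by_cases h : ends e i = v
  · simp only [h, if_true]
    abel
  · simp only [h, if_false]
    abel

theorem flagDegree_eq_splice_add {A : Finset E} {ends : E → Bool → V} {e f : E}
    (he : e ∈ A) (hf : f ∈ A) (hef : e ≠ f) {i j : Bool} (hu : ends e i = ends f j) (v : V) :
    flagDegree A ends v = flagDegree (A.erase f) (splice ends e i (ends f (!j))) v +
        if ends e i = v then 2 else 0 := by
  unfold flagDegree
  rw [flagSum_eq_splice_add he hf hef hu]
  congr 2
  funext x k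
  simp [splice]

theorem odd_flagDegree_splice_iff {A : Finset E} {ends : E → Bool → V} {e f : E}
    (he : e ∈ A) (hf : f ∈ A) (hef : e ≠ f) {i j : Bool} (hu : ends e i = ends f j) (v : V) :
    Odd (flagDegree (A.erase f) (splice ends e i (ends f (!j))) v) ↔
      Odd (flagDegree A ends v) := by
  rw [flagDegree_eq_splice_add he hf hef hu v]
  split_ifs
  · simp [Nat.odd_add]
  · simp

omit [DecidableEq V] in
theorem mem_iff_of_isFlagClosed_splice {A : Finset E} {ends : E → Bool → V} {e f : E} {i j : Bool}
    {S : Set V} (he : e ∈ A) (hef : e ≠ f)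
    (hS : IsFlagClosed (A.erase f) (splice ends e i (ends f (!j))) S) :
    ends e (!i) ∈ S ↔ ends f (!j) ∈ S := by
  have := hS e (Finset.mem_erase.mpr ⟨hef, he⟩) i
  rw [splice_self, splice_not] at this
  exact this.symm

omit [DecidableEq V] in
theorem mem_iff_of_isFlagClosed_splice_of_ne {A : Finset E} {ends : E → Bool → V} {e f x : E}
    {i j k : Bool} {S : Set V} (hx : x ∈ A) (hxe : x ≠ e) (hxf : x ≠ f)
    (hS : IsFlagClosed (A.erase f) (splice ends e i (ends f (!j))) S) :
    ends x k ∈ S ↔ ends x (!k) ∈ S := by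
  have := hS x (Finset.mem_erase.mpr ⟨hxf, hx⟩) k
  rwa [splice_of_ne _ hxe, splice_of_ne _ hxe] at this

omit [DecidableEq V] in
theorem IsFlagClosed.of_splice {A : Finset E} {ends : E → Bool → V} {e f : E} {i j : Bool}
    {S : Set V} (he : e ∈ A) (hef : e ≠ f) (hu : ends e i = ends f j)
    (hS : IsFlagClosed (A.erase f) (splice ends e i (ends f (!j))) S)
    (hi : ends e i ∈ S ↔ ends e (!i) ∈ S) : IsFlagClosed A ends S := by
  have hab := mem_iff_of_isFlagClosed_splice he hef hS
  intro x hx k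
  by_cases hxe : x = e
  · subst hxe
    rcases Bool.eq_or_eq_not k i with rfl | rfl
    · exact hi
    · rw [Bool.not_not]
      exact hi.symm
  by_cases hxf : x = f
  · subst hxf
    rcases Bool.eq_or_eq_not k j with rfl | rfl
    · rw [← hu, ← hab]
      exact hi
    · rw [Bool.not_not, ← hu, ← hab]
      exact hi.symm
  exact mem_iff_of_isFlagClosed_splice_of_ne hx hxe hxf hS

/-- A component without odd vertices that fusing `e` and `f` creates separates the common end
of `e` and `f` from their other ends. -/
theorem exists_separating_of_not_hasOddVertices {A : Finset E} {ends : E → Bool → V} {e f : E}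
    {i j : Bool} (hA : HasOddVertices A ends) (he : e ∈ A) (hf : f ∈ A) (hef : e ≠ f)
    (hu : ends e i = ends f j)
    (hbad : ¬ HasOddVertices (A.erase f) (splice ends e i (ends f (!j)))) :
    ∃ S : Set V, IsFlagClosed (A.erase f) (splice ends e i (ends f (!j))) S ∧
      (∀ v ∈ S, Even (flagDegree A ends v)) ∧ ¬ (ends e i ∈ S ↔ ends e (!i) ∈ S) := by
  unfold HasOddVertices at hbad
  push Not at hbad
  obtain ⟨S, hS, ⟨v, hv, hpos⟩, heven⟩ := hbad
  have heven' : ∀ v ∈ S, Even (flagDegree A ends v) := by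
    intro v hv
    rw [← Nat.not_odd_iff_even, ← odd_flagDegree_splice_iff he hf hef hu]
    exact heven v hv
  refine ⟨S, hS, heven', fun hi => ?_⟩
  obtain ⟨z, hz, hodd⟩ := hA S (hS.of_splice he hef hu hi) ⟨v, hv, by
    have := flagDegree_eq_splice_add he hf hef hu v
    omega⟩
  exact Nat.not_even_iff_odd.mpr hodd (heven' z hz)

omit [DecidableEq E] in
/-- The handshake lemma for a set of vertices. -/
theorem sum_flagDegree_mem [Fintype V] (A : Finset E) (ends : E → Bool → V) (R : Set V)
    [DecidablePred (· ∈ R)] :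
    ∑ v with v ∈ R, flagDegree A ends v = ∑ x ∈ A, ∑ k, if ends x k ∈ R then 1 else 0 := by
  unfold flagDegree flagSum
  rw [Finset.sum_comm]
  refine Finset.sum_congr rfl fun x _ => ?_
  rw [Finset.sum_comm]
  refine Finset.sum_congr rfl fun k _ => ?_
  rw [Finset.sum_ite_eq]
  simp

/-- If both fusions fail, they give separating sets `S` and `T`. The degree sum over `S ∩ T` is
even, as all degrees in `S` are. But edges other than `e`, `f`, `h` have both or neither end in `S ∩
T`, while these three have an odd number of ends there, wherever the common end lies. -/
theorem hasOddVertices_splice_or [Fintype V] {A : Finset E} {ends : E → Bool → V} {e f h : E}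
    {i j l : Bool} (hA : HasOddVertices A ends) (he : e ∈ A) (hf : f ∈ A) (hh : h ∈ A)
    (hef : e ≠ f) (heh : e ≠ h) (hfh : f ≠ h) (hu : ends e i = ends f j)
    (hu' : ends e i = ends h l) :
    HasOddVertices (A.erase f) (splice ends e i (ends f (!j))) ∨
      HasOddVertices (A.erase h) (splice ends e i (ends h (!l))) := by
  classical
  by_contra! hcon
  obtain ⟨S, hS, hSe, hSu⟩ := exists_separating_of_not_hasOddVertices hA he hf hef hu hcon.1
  obtain ⟨T, hT, -, hTu⟩ := exists_separating_of_not_hasOddVertices hA he hh heh hu' hcon.2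
  have hSf := mem_iff_of_isFlagClosed_splice he hef hS
  have hTh := mem_iff_of_isFlagClosed_splice he heh hT
  have hSh := mem_iff_of_isFlagClosed_splice_of_ne (k := l) hh heh.symm hfh.symm hS
  have hTf := mem_iff_of_isFlagClosed_splice_of_ne (k := j) hf hef.symm hfh hT
  have hsum := sum_flagDegree_mem A ends (S ∩ T)
  have heven : Even (∑ v with v ∈ S ∩ T, flagDegree A ends v) :=
    Finset.even_sum _ fun v hv => hSe v (Finset.mem_filter.mp hv).2.1
  have hrest : Even (∑ x ∈ ((A.erase e).erase f).erase h,
      ∑ k, if ends x k ∈ S ∩ T then 1 else 0) := by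
    refine Finset.even_sum _ fun x hx => ?_
    simp only [Finset.mem_erase] at hx
    have h1 := mem_iff_of_isFlagClosed_splice_of_ne (k := true) hx.2.2.2 hx.2.2.1 hx.2.1 hS
    have h2 := mem_iff_of_isFlagClosed_splice_of_ne (k := true) hx.2.2.2 hx.2.2.1 hx.1 hT
    rw [sum_bool_eq_add_not _ true]
    simp only [Set.mem_inter_iff, h1, h2]
    exact ⟨_, rfl⟩
  rw [hsum, ← Finset.add_sum_erase A _ he,
    ← Finset.add_sum_erase (A.erase e) _ (Finset.mem_erase.mpr ⟨hef.symm, hf⟩),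
    ← Finset.add_sum_erase ((A.erase e).erase f) _
      (Finset.mem_erase.mpr ⟨hfh.symm, Finset.mem_erase.mpr ⟨heh.symm, hh⟩⟩),
    ← add_assoc, ← add_assoc, Nat.even_add, iff_true_right hrest,
    sum_bool_eq_add_not _ i, sum_bool_eq_add_not _ j, sum_bool_eq_add_not _ l] at heven
  simp only [Set.mem_inter_iff, ← hu, ← hu', ← hSf, ← hTh] at *
  by_cases h1 : ends e i ∈ S <;> by_cases h2 : ends e i ∈ T <;> simp_all +decide

omit [DecidableEq E] in
theorem flagDegree_eq_sum_not (A : Finset E) (ends : E → Bool → V) (u : V) :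
    flagDegree A ends u =
      ∑ x ∈ A, ((if ends x false = u then 1 else 0) + if ends x true = u then 1 else 0) := by
  unfold flagDegree flagSum
  refine Finset.sum_congr rfl fun x _ => ?_
  rw [sum_bool_eq_add_not _ false]
  rfl

/-- At a vertex of degree at least two, some pair of edges can be fused. -/
theorem HasOddVertices.exists_splice [Fintype V] {A : Finset E} {ends : E → Bool → V}
    (hA : HasOddVertices A ends) {u : V} (hdeg : 2 ≤ flagDegree A ends u) :
    ∃ e ∈ A, ∃ f ∈ A, ∃ i j, e ≠ f ∧ ends e i = u ∧ ends f j = u ∧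
      HasOddVertices (A.erase f) (splice ends e i (ends f (!j))) := by
  classical
  by_cases hloop : ∃ e ∈ A, ∀ k, ends e k = u
  · obtain ⟨e, he, heu⟩ := hloop
    -- With only loops at `u`, its degree would be even and its component would have no odd vertex.
    -- So a non-loop edge `f` meets `u`; fusing it with the loop cannot separate `u` from the other
    -- end of the loop, which is `u` again.
    have hnc : ¬ IsFlagClosed A ends {u} := by
      intro hcl
      obtain ⟨v, rfl, hodd⟩ := hA _ hcl ⟨u, rfl, by omega⟩
      refine Nat.not_even_iff_odd.mpr hodd ?_
      rw [flagDegree_eq_sum_not]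
      refine Finset.even_sum _ fun x hx => ?_
      have := hcl x hx false
      simp only [Set.mem_singleton_iff, Bool.not_false] at this
      simp only [this]
      exact ⟨_, rfl⟩
    obtain ⟨f, hf, j, hfu, hfu'⟩ : ∃ f ∈ A, ∃ j, ends f j = u ∧ ends f (!j) ≠ u := by
      by_contra! hcon
      exact hnc fun x hx k => ⟨hcon x hx k, fun h => by simpa using hcon x hx (!k) h⟩
    have hef : e ≠ f := by
      rintro rfl
      exact hfu' (heu _)
    refine ⟨e, he, f, hf, true, j, hef, heu _, hfu, ?_⟩
    by_contra hbad
    obtain ⟨S, -, -, hS⟩ := exists_separating_of_not_hasOddVertices hA he hf hef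
      ((heu true).trans hfu.symm) hbad
    exact hS (by rw [heu, heu])
  · push Not at hloop
    set B := A.filter (fun x => ∃ k, ends x k = u) with hB
    have hcard : flagDegree A ends u = B.card := by
      rw [flagDegree_eq_sum_not, hB, Finset.card_filter]
      refine Finset.sum_congr rfl fun x hx => ?_
      have := hloop x hx
      simp only [Bool.exists_bool] at this ⊢
      by_cases h1 : ends x false = u <;> by_cases h2 : ends x true = u <;> simp_all
    by_cases hdeg3 : 2 < flagDegree A ends u
    · obtain ⟨e, he, f, hf, h, hh, hef, heh, hfh⟩ := Finset.two_lt_card.mp (hcard ▸ hdeg3)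
      simp only [hB, Finset.mem_filter] at he hf hh
      obtain ⟨he, i, hi⟩ := he
      obtain ⟨hf, j, hj⟩ := hf
      obtain ⟨hh, l, hl⟩ := hh
      rcases hasOddVertices_splice_or hA he hf hh hef heh hfh (hi.trans hj.symm)
        (hi.trans hl.symm) with hgood | hgood
      · exact ⟨e, he, f, hf, i, j, hef, hi, hj, hgood⟩
      · exact ⟨e, he, h, hh, i, l, heh, hi, hl, hgood⟩
    · have hdeg2 : flagDegree A ends u = 2 := by omega
      obtain ⟨e, f, hef, hBef⟩ := Finset.card_eq_two.mp (hcard.symm.trans hdeg2)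
      have heB : e ∈ B := by simp [hBef]
      have hfB : f ∈ B := by simp [hBef]
      simp only [hB, Finset.mem_filter] at heB hfB
      obtain ⟨he, i, hi⟩ := heB
      obtain ⟨hf, j, hj⟩ := hfB
      have hne : ∀ x ∈ A, ∀ k, ends x k = u → ends x (!k) ≠ u := by
        intro x hx k hk hk'
        obtain ⟨l, hl⟩ := hloop x hx
        rcases Bool.eq_or_eq_not l k with rfl | rfl
        · exact hl hk
        · exact hl hk'
      refine ⟨e, he, f, hf, i, j, hef, hi, hj, ?_⟩
      intro S hS ⟨v, hv, hpos⟩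
      have hdeg' := flagDegree_eq_splice_add he hf hef (hi.trans hj.symm)
      have hab := mem_iff_of_isFlagClosed_splice he hef hS
      -- Fusing the only two edges at `u` isolates it. Putting `u` back on the side of its
      -- neighbours makes the set closed before the fusion, and its odd vertex is not `u`, which has
      -- degree 2.
      set S' : Set V := {v | if v = u then ends e (!i) ∈ S else v ∈ S} with hS'
      have hmem : ∀ v, v ≠ u → (v ∈ S' ↔ v ∈ S) := by
        intro v hv
        simp [hS', hv]
      have hmemu : u ∈ S' ↔ ends e (!i) ∈ S := by simp [hS']
      have hvu : v ≠ u := by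
        rintro rfl
        have := hdeg' v
        rw [if_pos hi] at this
        omega
      have hcl : IsFlagClosed A ends S' := by
        intro x hx k
        have key : ∀ k, ends x k = u → (ends x k ∈ S' ↔ ends x (!k) ∈ S') := by
          intro k hk
          rw [hmem _ (hne x hx k hk), hk, hmemu]
          have hxB : x ∈ B := by
            simp only [hB, Finset.mem_filter]
            exact ⟨hx, k, hk⟩
          rw [hBef, Finset.mem_insert, Finset.mem_singleton] at hxB
          rcases hxB with rfl | rfl
          · rcases Bool.eq_or_eq_not k i with rfl | rfl
            · rfl
            · exact absurd hk (hne x hx i hi)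
          · rcases Bool.eq_or_eq_not k j with rfl | rfl
            · exact hab
            · exact absurd hk (hne x hx j hj)
        by_cases hk : ends x k = u
        · exact key k hk
        by_cases hk' : ends x (!k) = u
        · have := key (!k) hk'
          rw [Bool.not_not] at this
          exact this.symm
        rw [hmem _ hk, hmem _ hk']
        refine mem_iff_of_isFlagClosed_splice_of_ne hx ?_ ?_ hS
        · rintro rfl
          rcases Bool.eq_or_eq_not k i with rfl | rfl
          · exact hk hi
          · rw [Bool.not_not] at hk'
            exact hk' hi
        · rintro rfl
          rcases Bool.eq_or_eq_not k j with rfl | rfl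
          · exact hk hj
          · rw [Bool.not_not] at hk'
            exact hk' hj
      obtain ⟨z, hz, hodd⟩ := hA S' hcl ⟨v, (hmem v hvu).mpr hv, by
        have := hdeg' v
        omega⟩
      have hzu : z ≠ u := by
        rintro rfl
        rw [hdeg2] at hodd
        exact absurd hodd (by decide)
      exact ⟨z, (hmem z hzu).mp hz,
        (odd_flagDegree_splice_iff he hf hef (hi.trans hj.symm) z).mpr hodd⟩

/-! ### Signing a multigraph by induction on the number of edges. -/

omit [DecidableEq E] in
theorem abs_flagSum_le_and_emod_two {A : Finset E} {ends : E → Bool → V} {c : E → Bool → ℤ}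
    (hc : ∀ x k, c x k = 1 ∨ c x k = -1) (v : V) :
    |flagSum A ends c v| ≤ flagDegree A ends v ∧
      (flagSum A ends c v - flagDegree A ends v) % 2 = 0 := by
  unfold flagDegree flagSum
  constructor
  · push_cast
    refine (Finset.abs_sum_le_sum_abs _ _).trans (Finset.sum_le_sum fun x _ => ?_)
    refine (Finset.abs_sum_le_sum_abs _ _).trans (Finset.sum_le_sum fun k _ => ?_)
    rcases hc x k with h | h <;> split_ifs <;> simp [h]
  · push_cast
    rw [← Finset.sum_sub_distrib]
    refine Int.emod_eq_zero_of_dvd (Finset.dvd_sum fun x _ => ?_)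
    rw [← Finset.sum_sub_distrib]
    refine Finset.dvd_sum fun k _ => ?_
    rcases hc x k with h | h <;> split_ifs <;> simp [h]

/-- A multigraph whose components have odd vertices can be signed so that the sums at odd
vertices are `±1` and the sums at even vertices are `0` or `±2`, as prescribed by `t`. -/
theorem HasOddVertices.exists_signing [Fintype V] (t : V → Prop) {A : Finset E} :
    ∀ {ends : E → Bool → V} {w : E → Bool → ℤ}, HasOddVertices A ends →
      (∀ x k, w x k = 1 ∨ w x k = -1) →
      ∃ s : E → ℤ, (∀ x, s x = 1 ∨ s x = -1) ∧ ∀ v,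
        (Odd (flagDegree A ends v) → |flagSum A ends (fun x k => w x k * s x) v| = 1) ∧
        (Even (flagDegree A ends v) → ¬ t v → flagSum A ends (fun x k => w x k * s x) v = 0) ∧
        (Even (flagDegree A ends v) → t v → 0 < flagDegree A ends v →
          |flagSum A ends (fun x k => w x k * s x) v| = 2) := by
  classical
  induction hn : A.card generalizing A with
  | zero =>
    intro ends w _ _
    obtain rfl := Finset.card_eq_zero.mp hn
    exact ⟨fun _ => 1, fun _ => Or.inl rfl, fun v => by simp [flagDegree, flagSum]⟩
  | succ n ih =>
    intro ends w hA hw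
    by_cases hdeg : ∃ u, 2 ≤ flagDegree A ends u
    · obtain ⟨u, hu⟩ := hdeg
      obtain ⟨e, he, f, hf, i, j, hef, hi, hj, hgood⟩ := hA.exists_splice hu
      -- The sign of `f` will be `ε * s e`. The flags of `e` and `f` at `u` then cancel, except that
      -- the last pair at a vertex with `t u` adds up to ±2.
      set ε : ℤ := if t u ∧ flagDegree A ends u = 2 then w e i * w f j else -(w e i * w f j)
        with hε
      have hε1 : ε = 1 ∨ ε = -1 := by
        rcases hw e i with h1 | h1 <;> rcases hw f j with h2 | h2 <;> rw [hε] <;>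
          split_ifs <;> simp [h1, h2]
      obtain ⟨s, hs, hv⟩ := ih (by rw [Finset.card_erase_of_mem hf, hn]; rfl) hgood
        -- The fused edge inherits the far flag of `f`; its weight absorbs `ε`, so that flag keeps
        -- its contribution when expressed through `s e`. This is why weights are attached to flags.
        (w := splice w e i (ε * w f (!j))) (by
          intro x k
          unfold splice
          split_ifs
          · rcases hε1 with h1 | h1 <;> rcases hw f (!j) with h2 | h2 <;> simp [h1, h2]
          · exact hw x k)
      refine ⟨Function.update s f (ε * s e), ?_, fun v => ?_⟩
      · intro x
        by_cases hx : x = f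
        · subst hx
          rcases hε1 with h1 | h1 <;> rcases hs e with h2 | h2 <;> simp [h1, h2]
        · simpa [hx] using hs x
      · specialize hv v
        have hd := flagDegree_eq_splice_add he hf hef (hi.trans hj.symm) v
        have hflow := flagSum_eq_splice_add he hf hef (hi.trans hj.symm)
          (fun x k => w x k * Function.update s f (ε * s e) x) v
        have hcongr : flagSum (A.erase f) (splice ends e i (ends f (!j)))
            (splice (fun x k => w x k * Function.update s f (ε * s e) x) e i
              (w f (!j) * Function.update s f (ε * s e) f)) v =
            flagSum (A.erase f) (splice ends e i (ends f (!j)))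
              (fun x k => splice w e i (ε * w f (!j)) x k * s x) v := by
          refine Finset.sum_congr rfl fun x hx => Finset.sum_congr rfl fun k _ => ?_
          have hxf := (Finset.mem_erase.mp hx).1
          congr 1
          by_cases hxe : x = e ∧ k = i
          · obtain ⟨rfl, rfl⟩ := hxe
            simp only [splice_self, Function.update_self]
            ring
          · simp [splice, hxe, hxf]
        rw [hcongr] at hflow
        rw [hflow]
        rw [hi] at hd ⊢
        simp only [Function.update_of_ne hef, Function.update_self]
        by_cases huv : u = v
        · subst huv
          rw [if_pos rfl] at hd ⊢
          by_cases ht : t u ∧ flagDegree A ends u = 2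
          · have hε' : ε = w e i * w f j := by rw [hε, if_pos ht]
            have h0 : flagDegree (A.erase f) (splice ends e i (ends f (!j))) u = 0 := by omega
            have hz := (abs_flagSum_le_and_emod_two (A := A.erase f)
              (ends := splice ends e i (ends f (!j)))
              (c := fun x k => splice w e i (ε * w f (!j)) x k * s x) (by
                intro x k
                unfold splice
                split_ifs
                · rcases hε1 with h1 | h1 <;> rcases hw f (!j) with h2 | h2 <;>
                    rcases hs x with h3 | h3 <;> simp [h1, h2, h3]
                · rcases hw x k with h2 | h2 <;> rcases hs x with h3 | h3 <;> simp [h2, h3])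
              u).1
            rw [h0, Nat.cast_zero, abs_nonpos_iff] at hz
            rw [hz, ht.2]
            refine ⟨fun h => absurd h (by decide), fun _ h => absurd ht.1 h, fun _ _ _ => ?_⟩
            rw [hε']
            rcases hw e i with h1 | h1 <;> rcases hw f j with h2 | h2 <;>
              rcases hs e with h3 | h3 <;> simp [h1, h2, h3]
          · have hε' : ε = -(w e i * w f j) := by rw [hε, if_neg ht]
            have h0 : w e i * s e + w f j * (ε * s e) = 0 := by
              rw [hε']
              rcases hw f j with h2 | h2 <;> rw [h2] <;> ring
            rw [h0, add_zero, hd]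
            have hpar := Nat.even_add (m := flagDegree (A.erase f)
              (splice ends e i (ends f (!j))) u) (n := 2)
            simp only [even_two, iff_true] at hpar
            rw [← Nat.not_even_iff_odd, hpar]
            rw [← Nat.not_even_iff_odd] at hv
            refine ⟨hv.1, hv.2.1, fun h1 h2 _ => hv.2.2 h1 h2 ?_⟩
            have : flagDegree A ends u ≠ 2 := fun h => ht ⟨h2, h⟩
            omega
        · rw [if_neg huv, add_zero] at hd ⊢
          rw [hd]
          exact hv
    -- All degrees are now at most 1, so any signs work: the sum is ±1 at degree 1 and 0 at degree
    -- 0.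
    · push Not at hdeg
      refine ⟨fun _ => 1, fun _ => Or.inl rfl, fun v => ?_⟩
      have h := abs_flagSum_le_and_emod_two (A := A) (ends := ends)
        (c := fun x k => w x k * 1) (by simpa using hw) v
      obtain ⟨h1, h2⟩ := h
      simp only [mul_one] at h1 h2 ⊢
      have hd := hdeg v
      rw [abs_le] at h1
      refine ⟨fun hodd => ?_, fun heven _ => ?_, fun heven _ hpos => ?_⟩
      · have : flagDegree A ends v = 1 := by
          obtain ⟨m, hm⟩ := hodd
          omega
        rw [this] at h1 h2
        rw [abs_eq (by norm_num)]
        omega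
      · have : flagDegree A ends v = 0 := by
          obtain ⟨m, hm⟩ := heven
          omega
        rw [this] at h1
        omega
      · obtain ⟨m, hm⟩ := heven
        omega

end Multigraph

/-! ### Signing the bipartite graph through its augmentation. -/

section Bipartite

variable {V : Type*} [Fintype V] [DecidableEq V] (G : SimpleGraph V) [DecidableRel G.Adj]

theorem vertexSum_eq_sum_neighborFinset (f : Sym2 V → ℤ) (v : V) :
    vertexSum G f v = ∑ w ∈ G.neighborFinset v, f s(v, w) := by
  unfold vertexSum
  symm
  refine Finset.sum_bij (fun w _ => s(v, w)) ?_ ?_ ?_ ?_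
  · intro w hw
    rw [SimpleGraph.mem_neighborFinset] at hw
    simpa [SimpleGraph.mem_incidenceSet] using hw
  · intro a _ b _ h
    exact (Sym2.congr_right).mp h
  · intro e he
    rw [SimpleGraph.mem_incidenceFinset] at he
    obtain ⟨w, rfl⟩ := Sym2.mem_iff_exists.mp he.2
    exact ⟨w, by simpa using he.1, rfl⟩
  · intro w _
    rfl

theorem vertexSum_neg (f : Sym2 V → ℤ) (v : V) :
    vertexSum G (fun e => -f e) v = -vertexSum G f v := by
  simp [vertexSum]

variable {G} {X Y : Finset V}

theorem sum_edgeFinset_eq_sum_vertexSum (hbip : G.IsBipartiteWith (X : Set V) (Y : Set V))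
    (f : Sym2 V → ℤ) : ∑ e ∈ G.edgeFinset, f e = ∑ y ∈ Y, vertexSum G f y := by
  unfold vertexSum
  simp only [SimpleGraph.incidenceFinset_eq_filter, Finset.sum_filter]
  rw [Finset.sum_comm]
  refine Finset.sum_congr rfl fun e he => ?_
  have key : ∀ x ∈ X, ∀ y ∈ Y, f s(x, y) = ∑ z ∈ Y, if z ∈ s(x, y) then f s(x, y) else 0 := by
    intro x hx y hy
    rw [Finset.sum_eq_single_of_mem y hy]
    · simp
    · intro z hz hzy
      have hzx : z ≠ x := by
        rintro rfl
        exact Set.disjoint_left.mp hbip.disjoint hx hz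
      simp [hzy, hzx]
  induction e with
  | h a b =>
    rw [SimpleGraph.mem_edgeFinset, SimpleGraph.mem_edgeSet] at he
    rcases hbip.mem_of_adj he with ⟨h1, h2⟩ | ⟨h1, h2⟩
    · exact key a h1 b h2
    · rw [Sym2.eq_swap]
      exact key b h2 a h1

variable (G X Y) in
/-- The edges of `G`, written from `X` to `Y`, together with an edge from a new vertex `none`
to each odd vertex of `Y`. -/
def augmentedEdges : Finset (Option V × V) :=
  Finset.univ.filter fun p =>
    (∃ x ∈ X, p.1 = some x ∧ G.Adj x p.2) ∨ (p.1 = none ∧ p.2 ∈ Y ∧ Odd (G.degree p.2))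

/-- The end vertices of an augmented edge. -/
def augmentedEnds (p : Option V × V) (k : Bool) : Option V :=
  if k then some p.2 else p.1

theorem flagSum_augmented {M : Type*} [AddCommMonoid M] (c : Option V × V → M) (v : Option V) :
    flagSum (augmentedEdges G X Y) augmentedEnds (fun p _ => c p) v =
      (∑ y, if y ∈ Y ∧ Odd (G.degree y) then
        ((if some y = v then c (none, y) else 0) + if none = v then c (none, y) else 0) else 0) +
      ∑ x, ∑ y, if x ∈ X ∧ G.Adj x y then
        ((if some y = v then c (some x, y) else 0) +
          if some x = v then c (some x, y) else 0) else 0 := by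
  unfold flagSum augmentedEdges
  rw [Finset.sum_filter, Fintype.sum_prod_type, Fintype.sum_option]
  simp [augmentedEnds]

theorem flagSum_augmented_none {M : Type*} [AddCommMonoid M] (c : Option V × V → M) :
    flagSum (augmentedEdges G X Y) augmentedEnds (fun p _ => c p) none =
      ∑ y ∈ Y, if Odd (G.degree y) then c (none, y) else 0 := by
  rw [flagSum_augmented]
  simp [ite_and]

theorem flagSum_augmented_left {M : Type*} [AddCommMonoid M]
    (hbip : G.IsBipartiteWith (X : Set V) (Y : Set V)) (c : Option V × V → M) {x : V}
    (hx : x ∈ X) :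
    flagSum (augmentedEdges G X Y) augmentedEnds (fun p _ => c p) (some x) =
      ∑ y ∈ G.neighborFinset x, c (some x, y) := by
  have hxY : x ∉ Y := fun h => Set.disjoint_left.mp hbip.disjoint hx h
  rw [flagSum_augmented, Finset.sum_eq_zero, zero_add, Finset.sum_eq_single x]
  · rw [SimpleGraph.neighborFinset_eq_filter, Finset.sum_filter]
    refine Finset.sum_congr rfl fun y _ => ?_
    by_cases h : G.Adj x y
    · simp [h, hx, h.ne.symm]
    · simp [h]
  · intro z _ hz
    refine Finset.sum_eq_zero fun y _ => ?_
    split_ifs with h h1 h2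
    · obtain rfl := Option.some_injective _ h1
      exact absurd (hbip.mem_of_mem_adj h.1 h.2) hxY
    · exact absurd (Option.some_injective _ h1) (by
        rintro rfl
        exact hxY (hbip.mem_of_mem_adj h.1 h.2))
    · exact absurd (Option.some_injective _ ‹_›) hz
    · simp
    · rfl
  · simp
  · intro y _
    have hne : y ∈ Y → y ≠ x := by
      rintro hy rfl
      exact hxY hy
    by_cases h : y ∈ Y ∧ Odd (G.degree y)
    · simp [h, hne h.1]
    · rw [if_neg h]

theorem flagSum_augmented_right {M : Type*} [AddCommMonoid M]
    (hbip : G.IsBipartiteWith (X : Set V) (Y : Set V)) (c : Option V × V → M) {y : V}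
    (hy : y ∈ Y) :
    flagSum (augmentedEdges G X Y) augmentedEnds (fun p _ => c p) (some y) =
      (∑ x ∈ G.neighborFinset y, c (some x, y)) +
        if Odd (G.degree y) then c (none, y) else 0 := by
  have hyX : y ∉ X := fun h => Set.disjoint_left.mp hbip.disjoint h hy
  rw [flagSum_augmented, add_comm]
  congr 1
  · rw [SimpleGraph.neighborFinset_eq_filter, Finset.sum_filter]
    refine Finset.sum_congr rfl fun x _ => ?_
    rw [Finset.sum_eq_single y]
    · by_cases h : G.Adj y x
      · have hx : x ∈ X := hbip.symm.mem_of_mem_adj hy h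
        simp [h, h.symm, hx, h.ne.symm]
      · have h' : ¬ G.Adj x y := fun h' => h h'.symm
        simp [h, h']
    · intro z _ hz
      split_ifs with h h1 h2
      · exact absurd (Option.some_injective _ h1) hz
      · exact absurd (Option.some_injective _ h1) hz
      · obtain rfl := Option.some_injective _ ‹_›
        exact absurd h.1 hyX
      · simp
      · rfl
    · simp
  · rw [Finset.sum_eq_single y]
    · simp [hy]
    · intro z _ hz
      simp [hz]
    · simp

theorem flagDegree_augmented_left (hbip : G.IsBipartiteWith (X : Set V) (Y : Set V)) {x : V}
    (hx : x ∈ X) : flagDegree (augmentedEdges G X Y) augmentedEnds (some x) = G.degree x := by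
  unfold flagDegree
  rw [flagSum_augmented_left hbip (fun _ => 1) hx]
  simp

theorem flagDegree_augmented_right (hbip : G.IsBipartiteWith (X : Set V) (Y : Set V)) {y : V}
    (hy : y ∈ Y) : flagDegree (augmentedEdges G X Y) augmentedEnds (some y) =
      G.degree y + if Odd (G.degree y) then 1 else 0 := by
  unfold flagDegree
  rw [flagSum_augmented_right hbip (fun _ => 1) hy]
  simp

theorem flagDegree_augmented_none :
    flagDegree (augmentedEdges G X Y) augmentedEnds none =
      ∑ y ∈ Y, if Odd (G.degree y) then 1 else 0 :=
  flagSum_augmented_none fun _ => 1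

theorem IsFlagClosed.mem_of_adj (hbip : G.IsBipartiteWith (X : Set V) (Y : Set V))
    {S : Set (Option V)} (hS : IsFlagClosed (augmentedEdges G X Y) augmentedEnds S) {a b : V}
    (hab : G.Adj a b) (ha : some a ∈ S) : some b ∈ S := by
  have key : ∀ x ∈ X, ∀ y, G.Adj x y → (some x ∈ S ↔ some y ∈ S) := by
    intro x hx y hxy
    have := hS (some x, y) (by simp [augmentedEdges, hx, hxy]) false
    simpa [augmentedEnds] using this
  rcases hbip.mem_of_adj hab with ⟨h1, h2⟩ | ⟨h1, h2⟩
  · exact (key a h1 b hab).mp ha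
  · exact (key b h2 a hab.symm).mpr ha

theorem IsFlagClosed.mem_of_reachable (hbip : G.IsBipartiteWith (X : Set V) (Y : Set V))
    {S : Set (Option V)} (hS : IsFlagClosed (augmentedEdges G X Y) augmentedEnds S) {a b : V}
    (hab : G.Reachable a b) (ha : some a ∈ S) : some b ∈ S := by
  obtain ⟨p⟩ := hab
  induction p with
  | nil => exact ha
  | cons h _ ih => exact ih (hS.mem_of_adj hbip h ha)

/-- A non-Eulerian component of `G` has an odd vertex. One in `X` stays odd; one in `Y` becomes even
but is joined to `none`. The component in `hodd` is also joined to `none` through its odd vertex in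
`Y`, and its odd vertex in `X` serves for everything attached to `none`. -/
theorem hasOddVertices_augmented (hXY : X ∪ Y = Finset.univ)
    (hbip : G.IsBipartiteWith (X : Set V) (Y : Set V))
    (heul : ∀ C : G.ConnectedComponent, ¬ IsEulerianGraph C.toSimpleGraph)
    (hodd : (∀ y ∈ Y, Even (G.degree y)) ∨
      ∃ C : G.ConnectedComponent,
        (∃ x ∈ X, x ∈ C.supp ∧ Odd (G.degree x)) ∧
        (∃ y ∈ Y, y ∈ C.supp ∧ Odd (G.degree y))) :
    HasOddVertices (augmentedEdges G X Y) augmentedEnds := by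
  rintro S hS ⟨v, hv, hpos⟩
  have hnone : ∀ y ∈ Y, Odd (G.degree y) → (none ∈ S ↔ some y ∈ S) := by
    intro y hy hyo
    have := hS (none, y) (by simp [augmentedEdges, hy, hyo]) false
    simpa [augmentedEnds] using this
  have hoddY : none ∈ S → (∃ y ∈ Y, Odd (G.degree y)) →
      ∃ v ∈ S, Odd (flagDegree (augmentedEdges G X Y) augmentedEnds v) := by
    rintro hn ⟨y, hy, hyo⟩
    rcases hodd with heven | ⟨C, ⟨x, hx, hxC, hxo⟩, y', hy', hyC, hyo'⟩
    · exact absurd (heven y hy) (Nat.not_even_iff_odd.mpr hyo)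
    · refine ⟨some x, hS.mem_of_reachable hbip (C.reachable_of_mem_supp hyC hxC)
        ((hnone y' hy' hyo').mp hn), ?_⟩
      rwa [flagDegree_augmented_left hbip hx]
  match v with
  | none =>
    refine hoddY hv ?_
    by_contra! hcon
    rw [flagDegree_augmented_none, Finset.sum_eq_zero] at hpos
    · exact lt_irrefl _ hpos
    · intro y hy
      rw [if_neg (Nat.not_odd_iff_even.mpr (by simpa using hcon y hy))]
  | some a =>
    obtain ⟨z, hz, hzo⟩ := exists_odd_degree_mem_supp G (G.connectedComponentMk a) (heul _)
    have hzS : some z ∈ S := hS.mem_of_reachable hbip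
      ((G.connectedComponentMk a).reachable_of_mem_supp rfl hz) hv
    have hzXY : z ∈ X ∪ Y := hXY ▸ Finset.mem_univ z
    rcases Finset.mem_union.mp hzXY with hzX | hzY
    · exact ⟨some z, hzS, by rwa [flagDegree_augmented_left hbip hzX]⟩
    · exact hoddY ((hnone z hzY hzo).mpr hzS) ⟨z, hzY, hzo⟩

variable (X) in
/-- The sign of an edge of `G` read off from a sign function on pairs. -/
def edgeSign (s : Option V × V → ℤ) : Sym2 V → ℤ :=
  Sym2.lift ⟨fun a b => if a ∈ X ∧ b ∉ X then s (some a, b) else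
    if b ∈ X ∧ a ∉ X then s (some b, a) else 1, by
      intro a b
      by_cases ha : a ∈ X <;> by_cases hb : b ∈ X <;> simp [ha, hb]⟩

omit [Fintype V] in
theorem edgeSign_mk {s : Option V × V → ℤ} {a b : V} (ha : a ∈ X) (hb : b ∉ X) :
    edgeSign X s s(a, b) = s (some a, b) := by
  simp [edgeSign, ha, hb]

omit [Fintype V] in
theorem edgeSign_eq_one_or {s : Option V × V → ℤ} (hs : ∀ p, s p = 1 ∨ s p = -1) (e : Sym2 V) :
    edgeSign X s e = 1 ∨ edgeSign X s e = -1 := by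
  induction e with
  | h a b =>
    simp only [edgeSign, Sym2.lift_mk]
    split_ifs
    · exact hs _
    · exact hs _
    · exact Or.inl rfl

theorem vertexSum_edgeSign_left (hbip : G.IsBipartiteWith (X : Set V) (Y : Set V))
    (s : Option V × V → ℤ) {x : V} (hx : x ∈ X) :
    vertexSum G (edgeSign X s) x =
      flagSum (augmentedEdges G X Y) augmentedEnds (fun p _ => s p) (some x) := by
  rw [flagSum_augmented_left hbip s hx, vertexSum_eq_sum_neighborFinset]
  refine Finset.sum_congr rfl fun y hy => edgeSign_mk hx ?_
  exact fun h => Set.disjoint_left.mp hbip.disjoint h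
    (hbip.mem_of_mem_adj hx (by simpa using hy))

theorem vertexSum_edgeSign_right (hbip : G.IsBipartiteWith (X : Set V) (Y : Set V))
    (s : Option V × V → ℤ) {y : V} (hy : y ∈ Y) :
    vertexSum G (edgeSign X s) y + (if Odd (G.degree y) then s (none, y) else 0) =
      flagSum (augmentedEdges G X Y) augmentedEnds (fun p _ => s p) (some y) := by
  rw [flagSum_augmented_right hbip s hy, vertexSum_eq_sum_neighborFinset]
  congr 1
  refine Finset.sum_congr rfl fun x hx => ?_
  rw [Sym2.eq_swap]
  exact edgeSign_mk (hbip.symm.mem_of_mem_adj hy (by simpa using hx))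
    fun h => Set.disjoint_left.mp hbip.disjoint h hy

/-- The signings of `G` that satisfy the requirements on the vertex sums. -/
structure IsGoodSigning (G : SimpleGraph V) [DecidableRel G.Adj] (X Y : Finset V) (D : ℤ)
    (g : Sym2 V → ℤ) : Prop where
  sign : ∀ e ∈ G.edgeFinset, g e = 1 ∨ g e = -1
  sum_eq : ∑ e ∈ G.edgeFinset, g e = D
  left : ∀ x ∈ X, ¬ (3 : ℤ) ∣ vertexSum G g x
  right_even : (∀ y ∈ Y, Even (G.degree y)) →
    ∃ y' ∈ Y, (vertexSum G g y' = 0 ∨ |vertexSum G g y'| = 2) ∧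
      ∀ y ∈ Y, y ≠ y' → vertexSum G g y = 0
  right_odd : (∃ y ∈ Y, Odd (G.degree y)) → ∀ y ∈ Y, |vertexSum G g y| ≤ 1

theorem IsGoodSigning.neg {D : ℤ} {g : Sym2 V → ℤ} (hg : IsGoodSigning G X Y D g) :
    IsGoodSigning G X Y (-D) (fun e => -g e) where
  sign e he := by
    rcases hg.sign e he with h | h <;> simp [h]
  sum_eq := by rw [Finset.sum_neg_distrib, hg.sum_eq]
  left x hx := by
    rw [vertexSum_neg, dvd_neg]
    exact hg.left x hx
  right_even h := by
    simpa only [vertexSum_neg, abs_neg, neg_eq_zero] using hg.right_even h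
  right_odd h := by
    simpa only [vertexSum_neg, abs_neg] using hg.right_odd h

theorem sum_sign_emod_two {E : Type*} {A : Finset E} {g : E → ℤ}
    (hg : ∀ e ∈ A, g e = 1 ∨ g e = -1) : (∑ e ∈ A, g e - A.card) % 2 = 0 := by
  rw [Finset.card_eq_sum_ones, Nat.cast_sum, ← Finset.sum_sub_distrib]
  refine Int.emod_eq_zero_of_dvd (Finset.dvd_sum fun e he => ?_)
  rcases hg e he with h | h <;> simp [h]

theorem exists_isGoodSigning [Nonempty V] (hXY : X ∪ Y = Finset.univ)
    (hbip : G.IsBipartiteWith (X : Set V) (Y : Set V)) (hiso : ∀ v : V, G.degree v ≠ 0)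
    (heul : ∀ C : G.ConnectedComponent, ¬ IsEulerianGraph C.toSimpleGraph)
    (hodd : (∀ y ∈ Y, Even (G.degree y)) ∨
      ∃ C : G.ConnectedComponent,
        (∃ x ∈ X, x ∈ C.supp ∧ Odd (G.degree x)) ∧
        (∃ y ∈ Y, y ∈ C.supp ∧ Odd (G.degree y)))
    {D : ℤ} (hD : |D| ≤ 2) (hpar : (D - G.edgeFinset.card) % 2 = 0) :
    ∃ g, IsGoodSigning G X Y D g := by
  classical
  obtain ⟨y₀, hy₀⟩ : ∃ y, y ∈ Y := by
    obtain ⟨v⟩ := ‹Nonempty V›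
    rcases Finset.mem_union.mp (hXY ▸ Finset.mem_univ v : v ∈ X ∪ Y) with hv | hv
    · obtain ⟨w, hw⟩ := (G.degree_pos_iff_exists_adj v).mp (Nat.pos_of_ne_zero (hiso v))
      exact ⟨w, hbip.mem_of_mem_adj hv hw⟩
    · exact ⟨v, hv⟩
  -- The vertices where an even degree should give ±2: all of `X`, and, when `|D| = 2`, the vertex
  -- that carries the total, namely `none`, or `y₀` if `Y` has no odd vertex.
  let t : Option V → Prop := fun v =>
    (∃ x ∈ X, v = some x) ∨ (v = none ∧ |D| = 2) ∨
      (v = some y₀ ∧ |D| = 2 ∧ ∀ y ∈ Y, Even (G.degree y))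
  obtain ⟨s, hs, hst⟩ := (hasOddVertices_augmented hXY hbip heul hodd).exists_signing t
    (w := fun _ _ => 1) (fun _ _ => Or.inl rfl)
  simp only [one_mul] at hst
  set g := edgeSign X s with hg
  have hgs : ∀ e ∈ G.edgeFinset, g e = 1 ∨ g e = -1 := fun e _ => edgeSign_eq_one_or hs e
  have hleft : ∀ x ∈ X, ¬ (3 : ℤ) ∣ vertexSum G g x := by
    intro x hx
    rw [hg, vertexSum_edgeSign_left hbip s hx]
    obtain ⟨h1, -, h3⟩ := hst (some x)
    rw [flagDegree_augmented_left hbip hx] at h1 h3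
    rw [← dvd_abs]
    rcases Nat.even_or_odd (G.degree x) with he | ho
    · rw [h3 he (Or.inl ⟨x, hx, rfl⟩) (Nat.pos_of_ne_zero (hiso x))]
      decide
    · rw [h1 ho]
      decide
  have hdegY : ∀ y ∈ Y, Even (flagDegree (augmentedEdges G X Y) augmentedEnds (some y)) := by
    intro y hy
    rw [flagDegree_augmented_right hbip hy]
    split_ifs with h
    · exact h.add_one
    · simpa using h
  have hflow : ∀ y ∈ Y, ¬ t (some y) →
      flagSum (augmentedEdges G X Y) augmentedEnds (fun p _ => s p) (some y) = 0 :=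
    fun y hy ht => (hst (some y)).2.1 (hdegY y hy) ht
  have hdisj : ∀ y ∈ Y, y ∉ X := fun y hy hx => Set.disjoint_left.mp hbip.disjoint hx hy
  have hTpar := sum_sign_emod_two hgs
  have hTY := sum_edgeFinset_eq_sum_vertexSum hbip g
  -- Only the absolute value of the total is controlled; negating all signs corrects the rest.
  suffices h : IsGoodSigning G X Y (∑ e ∈ G.edgeFinset, g e) g ∧
      |∑ e ∈ G.edgeFinset, g e| = |D| by
    rcases abs_eq_abs.mp h.2 with h' | h'
    · exact ⟨g, h' ▸ h.1⟩
    · have := h.1.neg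
      rw [h', neg_neg] at this
      exact ⟨_, this⟩
  rw [abs_le] at hD
  by_cases hY : ∀ y ∈ Y, Even (G.degree y)
  · have hnodd : ∀ y ∈ Y, ¬ Odd (G.degree y) := fun y hy => Nat.not_odd_iff_even.mpr (hY y hy)
    have hsumY : ∀ y ∈ Y, vertexSum G g y =
        flagSum (augmentedEdges G X Y) augmentedEnds (fun p _ => s p) (some y) := by
      intro y hy
      rw [← vertexSum_edgeSign_right hbip s hy, if_neg (hnodd y hy), add_zero]
    have hzero : ∀ y ∈ Y, y ≠ y₀ → vertexSum G g y = 0 := by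
      intro y hy hne
      rw [hsumY y hy]
      refine hflow y hy ?_
      rintro (⟨x, hx, h⟩ | ⟨h, -⟩ | ⟨h, -⟩)
      · exact hdisj y hy (Option.some_injective _ h ▸ hx)
      · simp at h
      · exact hne (Option.some_injective _ h)
    have hT : ∑ e ∈ G.edgeFinset, g e = vertexSum G g y₀ := by
      rw [hTY, Finset.sum_eq_single_of_mem y₀ hy₀ hzero]
    have hy₀D : |vertexSum G g y₀| = |D| ∧ (vertexSum G g y₀ = 0 ∨ |vertexSum G g y₀| = 2) := by
      by_cases hD2 : |D| = 2
      · have : |vertexSum G g y₀| = 2 := by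
          rw [hsumY y₀ hy₀]
          refine (hst (some y₀)).2.2 (hdegY y₀ hy₀) (Or.inr (Or.inr ⟨rfl, hD2, hY⟩)) ?_
          rw [flagDegree_augmented_right hbip hy₀]
          have := hiso y₀
          omega
        exact ⟨this.trans hD2.symm, Or.inr this⟩
      · have h0 : vertexSum G g y₀ = 0 := by
          rw [hsumY y₀ hy₀]
          refine hflow y₀ hy₀ ?_
          rintro (⟨x, hx, h⟩ | ⟨h, -⟩ | ⟨-, h, -⟩)
          · exact hdisj y₀ hy₀ (Option.some_injective _ h ▸ hx)
          · simp at h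
          · exact hD2 h
        refine ⟨?_, Or.inl h0⟩
        rw [hT, h0] at hTpar
        rw [abs_eq (by norm_num)] at hD2
        have : D = 0 := by omega
        rw [h0, this]
    refine ⟨⟨hgs, rfl, hleft, fun _ => ⟨y₀, hy₀, hy₀D.2, hzero⟩, ?_⟩, ?_⟩
    · rintro ⟨y, hy, ho⟩
      exact absurd ho (hnodd y hy)
    · rw [hT, hy₀D.1]
  · have hsumY : ∀ y ∈ Y, vertexSum G g y = -(if Odd (G.degree y) then s (none, y) else 0) := by
      intro y hy
      rw [eq_neg_iff_add_eq_zero, hg, vertexSum_edgeSign_right hbip s hy]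
      refine hflow y hy ?_
      rintro (⟨x, hx, h⟩ | ⟨h, -⟩ | ⟨-, -, h⟩)
      · exact hdisj y hy (Option.some_injective _ h ▸ hx)
      · simp at h
      · exact hY h
    have hT : ∑ e ∈ G.edgeFinset, g e =
        -flagSum (augmentedEdges G X Y) augmentedEnds (fun p _ => s p) none := by
      rw [hTY, flagSum_augmented_none s, ← Finset.sum_neg_distrib]
      exact Finset.sum_congr rfl hsumY
    refine ⟨⟨hgs, rfl, hleft, fun h => absurd h hY, fun _ y hy => ?_⟩, ?_⟩
    · rw [hsumY y hy, abs_neg]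
      split_ifs
      · rcases hs (none, y) with h | h <;> simp [h]
      · simp
    · have hnt : t none ↔ |D| = 2 := by simp [t]
      obtain ⟨h1, h2, h3⟩ := hst none
      rw [hnt] at h2 h3
      have hpos : 0 < flagDegree (augmentedEdges G X Y) augmentedEnds none := by
        push Not at hY
        obtain ⟨y, hy, ho⟩ := hY
        rw [flagDegree_augmented_none]
        refine Finset.sum_pos' (fun _ _ => Nat.zero_le _) ⟨y, hy, ?_⟩
        rw [if_pos (by simpa using ho)]
        exact one_pos
      set F := flagSum (augmentedEdges G X Y) augmentedEnds (fun p _ => s p) none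
      rw [hT] at hTpar ⊢
      rw [abs_neg]
      rcases Nat.even_or_odd (flagDegree (augmentedEdges G X Y) augmentedEnds none) with he | ho
      · by_cases hD2 : |D| = 2
        · rw [h3 he hD2 hpos, hD2]
        · have hF := h2 he hD2
          rw [hF] at hTpar ⊢
          rw [abs_eq (by norm_num)] at hD2
          have : D = 0 := by omega
          rw [this]
      -- The total is ±1, so `D` is odd by parity, and `|D| ≤ 2` forces `|D| = 1`.
      · have hF := h1 ho
        rw [hF]
        rw [abs_eq (by norm_num)] at hF
        symm
        rw [abs_eq (by norm_num)]
        omega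

end Bipartite

/-! ### Obtaining both residues over `X`, and passing from signs to labels. -/

section Bipartite

variable {V : Type*} [Fintype V] [DecidableEq V] {G : SimpleGraph V} [DecidableRel G.Adj]
  {X Y : Finset V}

theorem sum_sign_eq_card_sub_card {E : Type*} {A : Finset E} {g : E → ℤ}
    (hg : ∀ e ∈ A, g e = 1 ∨ g e = -1) :
    ∑ e ∈ A, g e = ((A.filter (g · = 1)).card : ℤ) - (A.filter (g · = -1)).card := by
  simp only [Finset.card_filter, Nat.cast_sum]
  rw [← Finset.sum_sub_distrib]
  refine Finset.sum_congr rfl fun e he => ?_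
  rcases hg e he with h | h <;> simp [h]

theorem card_filter_sign_add {E : Type*} {A : Finset E} {g : E → ℤ}
    (hg : ∀ e ∈ A, g e = 1 ∨ g e = -1) :
    (A.filter (g · = 1)).card + (A.filter (g · = -1)).card = A.card := by
  rw [Finset.card_filter, Finset.card_filter, Finset.card_eq_sum_ones, ← Finset.sum_add_distrib]
  refine Finset.sum_congr rfl fun e he => ?_
  rcases hg e he with h | h <;> simp [h]

theorem vertexSum_add_single (g : Sym2 V → ℤ) {e₀ : Sym2 V} (he₀ : e₀ ∈ G.edgeFinset) (c : ℤ)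
    (v : V) : vertexSum G (fun e => g e + if e = e₀ then c else 0) v =
      vertexSum G g v + if v ∈ e₀ then c else 0 := by
  unfold vertexSum
  rw [Finset.sum_add_distrib, Finset.sum_ite_eq']
  simp [SimpleGraph.incidenceFinset_eq_filter, he₀]

theorem two_le_card_filter_sign {g : Sym2 V → ℤ} (hg : ∀ e ∈ G.edgeFinset, g e = 1 ∨ g e = -1)
    {y : V} (hy : |vertexSum G g y| ≤ 1) (hdeg : 4 ≤ G.degree y) :
    2 ≤ ((G.neighborFinset y).filter (fun x => g s(y, x) = 1)).card ∧
      2 ≤ ((G.neighborFinset y).filter (fun x => g s(y, x) = -1)).card := by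
  have hg' : ∀ x ∈ G.neighborFinset y, g s(y, x) = 1 ∨ g s(y, x) = -1 := fun x hx =>
    hg _ (by simpa using hx)
  have h1 := sum_sign_eq_card_sub_card hg'
  have h2 := card_filter_sign_add hg'
  rw [← vertexSum_eq_sum_neighborFinset] at h1
  rw [G.card_neighborFinset_eq_degree] at h2
  rw [abs_le] at hy
  omega

/-- If all the sums over `X` are `1` modulo `3`, then they can be changed to `2` at some
vertices. -/
theorem IsGoodSigning.exists_swap {D : ℤ} {g : Sym2 V → ℤ} (hg : IsGoodSigning G X Y D g)
    (hbip : G.IsBipartiteWith (X : Set V) (Y : Set V))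
    (h1 : ∀ x ∈ X, vertexSum G g x % 3 = 1) {B : Finset V} (hBY : B ⊆ Y) (hB : B.Nonempty)
    (hXB : X.card ≤ B.card) (hdeg : ∀ y ∈ B, 4 ≤ G.degree y) :
    ∃ g', IsGoodSigning G X Y D g' ∧ (∃ x ∈ X, vertexSum G g' x % 3 = 1) ∧
      ∃ x ∈ X, vertexSum G g' x % 3 = 2 := by
  have hnX : ∀ y ∈ Y, ∀ x, G.Adj y x → x ∈ X := fun y hy x h => hbip.symm.mem_of_mem_adj hy h
  have hne : ∀ x ∈ X, ∀ y ∈ Y, x ≠ y := by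
    rintro x hx y hy rfl
    exact Set.disjoint_left.mp hbip.disjoint hx hy
  have hX4 : 4 ≤ X.card := by
    obtain ⟨y, hy⟩ := hB
    refine (hdeg y hy).trans ?_
    rw [← G.card_neighborFinset_eq_degree]
    exact Finset.card_le_card fun x hx => hnX y (hBY hy) x (by simpa using hx)
  obtain ⟨y', hy'⟩ : ∃ y', ∀ y ∈ Y, y ≠ y' → |vertexSum G g y| ≤ 1 := by
    by_cases hY : ∀ y ∈ Y, Even (G.degree y)
    · obtain ⟨y', -, -, h⟩ := hg.right_even hY
      exact ⟨y', fun y hy hne => by simp [h y hy hne]⟩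
    · push Not at hY
      obtain ⟨y, hy, ho⟩ := hY
      exact ⟨y, fun z hz _ => hg.right_odd ⟨y, hy, by simpa using ho⟩ z hz⟩
  have hB' : ∀ y ∈ B.erase y',
      2 ≤ ((G.neighborFinset y).filter (fun x => g s(y, x) = 1)).card ∧
        2 ≤ ((G.neighborFinset y).filter (fun x => g s(y, x) = -1)).card := by
    intro y hy
    have hy2 := Finset.mem_erase.mp hy
    exact two_le_card_filter_sign hg.sign (hy' y (hBY hy2.2) hy2.1) (hdeg y hy2.2)
  -- Otherwise counting negative edges from `B.erase y'` gives `2 * (B.card - 1) ≤ X.card ≤ B.card`,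
  -- against `4 ≤ X.card`.
  obtain ⟨z, hz, hz2⟩ : ∃ z ∈ X, 1 < ((B.erase y').bipartiteBelow
      (fun y x => G.Adj y x ∧ g s(y, x) = -1) z).card := by
    by_contra! hcon
    have := Finset.card_mul_le_card_mul (s := B.erase y') (t := X) (m := 2) (n := 1)
      (fun y x => G.Adj y x ∧ g s(y, x) = -1) ?_ hcon
    · have := Finset.pred_card_le_card_erase (s := B) (a := y')
      omega
    · intro y hy
      refine (hB' y hy).2.trans (Finset.card_le_card fun x hx => ?_)
      rw [Finset.mem_filter, SimpleGraph.mem_neighborFinset] at hx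
      rw [Finset.mem_bipartiteAbove]
      exact ⟨hnX y (hBY (Finset.mem_of_mem_erase hy)) x hx.1, hx⟩
  obtain ⟨a, ha, b, hb, hab⟩ := Finset.one_lt_card.mp hz2
  rw [Finset.mem_bipartiteBelow] at ha hb
  obtain ⟨haB, haz, hga⟩ := ha
  obtain ⟨hbB, hbz, hgb⟩ := hb
  have haY : a ∈ Y := hBY (Finset.mem_of_mem_erase haB)
  have hbY : b ∈ Y := hBY (Finset.mem_of_mem_erase hbB)
  obtain ⟨u, hu⟩ := Finset.card_pos.mp (zero_lt_two.trans_le (hB' a haB).1)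
  -- `w ≠ u` matters: losing 4 at one vertex would turn its residue 1 into 0.
  obtain ⟨w, hw, hwu⟩ := Finset.exists_mem_ne (one_lt_two.trans_le (hB' b hbB).1) u
  rw [Finset.mem_filter, SimpleGraph.mem_neighborFinset] at hu hw
  obtain ⟨hau, hgu⟩ := hu
  obtain ⟨hbw, hgw⟩ := hw
  have huX := hnX a haY u hau
  have hwX := hnX b hbY w hbw
  have hzu : z ≠ u := by
    rintro rfl
    omega
  have hzw : z ≠ w := by
    rintro rfl
    omega
  obtain ⟨q, hqX, hq⟩ : ∃ q ∈ X, q ∉ ({z, u, w} : Finset V) := by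
    refine Finset.exists_mem_notMem_of_card_lt_card ?_
    exact Finset.card_le_three.trans_lt hX4
  simp only [Finset.mem_insert, Finset.mem_singleton, not_or] at hq
  -- The negative edges `az`, `bz` become positive and the positive edges `au`, `bw` negative. Sums
  -- at `a` and `b` are unchanged; `z` gains 4 and `u`, `w` lose 2, all moving from residue 1 to 2,
  -- while `q` keeps residue 1.
  set g' : Sym2 V → ℤ := fun e => (((g e + if e = s(a, z) then 2 else 0) +
    if e = s(b, z) then 2 else 0) + if e = s(a, u) then -2 else 0) +
    if e = s(b, w) then -2 else 0 with hg'
  have hvs : ∀ v, vertexSum G g' v = (((vertexSum G g v + if v ∈ s(a, z) then 2 else 0) +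
      if v ∈ s(b, z) then 2 else 0) + if v ∈ s(a, u) then -2 else 0) +
      if v ∈ s(b, w) then -2 else 0 := by
    intro v
    rw [hg', vertexSum_add_single _ (by simpa using hbw), vertexSum_add_single _ (by simpa using hau),
      vertexSum_add_single _ (by simpa using hbz), vertexSum_add_single _ (by simpa using haz)]
  have hvsY : ∀ y ∈ Y, vertexSum G g' y = vertexSum G g y := by
    intro y hy
    rw [hvs]
    have h1 := (hne z hz y hy).symm
    have h2 := (hne u huX y hy).symm
    have h3 := (hne w hwX y hy).symm
    simp only [Sym2.mem_iff, h1, h2, h3, or_false]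
    split_ifs <;> ring
  have hvsX : ∀ x ∈ X, vertexSum G g' x = (((vertexSum G g x + if x = z then 2 else 0) +
      if x = z then 2 else 0) + if x = u then -2 else 0) + if x = w then -2 else 0 := by
    intro x hx
    rw [hvs]
    simp only [Sym2.mem_iff, hne x hx a haY, hne x hx b hbY, false_or]
  refine ⟨g', ⟨?_, ?_, ?_, ?_, ?_⟩, ⟨q, hqX, ?_⟩, z, hz, ?_⟩
  · intro e he
    have hd : s(a, u) ≠ s(b, w) := by
      intro h
      rcases Sym2.eq_iff.mp h with ⟨h, -⟩ | ⟨-, h⟩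
      · exact hab h
      · exact hne u huX b hbY h
    have hd' : s(a, z) ≠ s(b, z) := by
      intro h
      rcases Sym2.eq_iff.mp h with ⟨h, -⟩ | ⟨-, h⟩
      · exact hab h
      · exact hne z hz b hbY h
    have hd1 : ∀ {e e'}, g e = 1 → g e' = -1 → e ≠ e' := by
      rintro e e' h h' rfl
      omega
    simp only [hg']
    by_cases e1 : e = s(a, z)
    · subst e1
      simp [hga, hd', (hd1 hgu hga).symm, (hd1 hgw hga).symm]
    by_cases e2 : e = s(b, z)
    · subst e2
      simp [hgb, hd'.symm, (hd1 hgu hgb).symm, (hd1 hgw hgb).symm]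
    by_cases e3 : e = s(a, u)
    · subst e3
      simp [hgu, e1, e2, hd]
    by_cases e4 : e = s(b, w)
    · subst e4
      simp [hgw, e1, e2, e3]
    simpa [e1, e2, e3, e4] using hg.sign e he
  · rw [sum_edgeFinset_eq_sum_vertexSum hbip, Finset.sum_congr rfl hvsY,
      ← sum_edgeFinset_eq_sum_vertexSum hbip, hg.sum_eq]
  · intro x hx
    have := h1 x hx
    rw [hvsX x hx]
    by_cases x1 : x = z
    · subst x1
      simp only [if_true, if_neg hzu, if_neg hzw]
      omega
    by_cases x2 : x = u
    · subst x2
      simp only [if_true, if_neg x1, if_neg hwu.symm]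
      omega
    simp only [if_neg x1, if_neg x2]
    split_ifs <;> omega
  · intro h
    obtain ⟨v, hv, h2, h3⟩ := hg.right_even h
    refine ⟨v, hv, ?_, fun y hy hyv => ?_⟩
    · rwa [hvsY v hv]
    · rw [hvsY y hy, h3 y hy hyv]
  · intro h y hy
    rw [hvsY y hy]
    exact hg.right_odd h y hy
  · rw [hvsX q hqX, if_neg hq.1, if_neg hq.2.1, if_neg hq.2.2]
    simpa using h1 q hqX
  · rw [hvsX z hz, if_pos rfl, if_neg hzu, if_neg hzw]
    have := h1 z hz
    omega

/-- A good signing can be chosen so that both nonzero residues occur as sums over `X`. -/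
theorem IsGoodSigning.exists_both_residues {D : ℤ} {g : Sym2 V → ℤ}
    (hg : IsGoodSigning G X Y D g) (hbip : G.IsBipartiteWith (X : Set V) (Y : Set V))
    {B : Finset V} (hBY : B ⊆ Y) (hB : B.Nonempty) (hXB : X.card ≤ B.card)
    (hdeg : ∀ y ∈ B, 4 ≤ G.degree y) :
    ∃ g', IsGoodSigning G X Y D g' ∧ (∃ x ∈ X, vertexSum G g' x % 3 = 1) ∧
      ∃ x ∈ X, vertexSum G g' x % 3 = 2 := by
  have hleft := hg.left
  by_cases h1 : ∀ x ∈ X, vertexSum G g x % 3 = 1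
  · exact hg.exists_swap hbip h1 hBY hB hXB hdeg
  by_cases h2 : ∀ x ∈ X, vertexSum G g x % 3 = 2
  · obtain ⟨g', hg', ⟨x, hx, hx1⟩, x', hx', hx2⟩ := hg.neg.exists_swap hbip (fun x hx => by
      have := h2 x hx
      rw [vertexSum_neg]
      omega) hBY hB hXB hdeg
    refine ⟨_, neg_neg D ▸ hg'.neg, ⟨x', hx', ?_⟩, x, hx, ?_⟩ <;> rw [vertexSum_neg] <;> omega
  push Not at h1 h2
  obtain ⟨x, hx, hx1⟩ := h1
  obtain ⟨x', hx', hx2⟩ := h2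
  have h3 := hleft x hx
  have h4 := hleft x' hx'
  exact ⟨g, hg, ⟨x', hx', by omega⟩, x, hx, by omega⟩

/-- The sum and difference of the sizes of the two sign classes agree with those of the two label
classes, so corresponding classes are equinumerous and bijections between them can be glued. -/
theorem exists_labeling_of_sign {L : Finset ℤ} {g : Sym2 V → ℤ}
    (hg : ∀ e ∈ G.edgeFinset, g e = 1 ∨ g e = -1) (hL : ∀ j ∈ L, IsMuLabel 1 j ∨ IsMuLabel 2 j)
    (hcard : (L.filter (fun j => IsMuLabel 1 j)).card + (L.filter (fun j => IsMuLabel 2 j)).card =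
      G.edgeFinset.card)
    (hsum : ∑ e ∈ G.edgeFinset, g e = ((L.filter (fun j => IsMuLabel 1 j)).card : ℤ) -
      (L.filter (fun j => IsMuLabel 2 j)).card) :
    ∃ f, IsLabeling G L f ∧ ∀ e ∈ G.edgeFinset,
      (g e = 1 ∧ f e % 3 = 1) ∨ (g e = -1 ∧ f e % 3 = 2) := by
  have h1 := sum_sign_eq_card_sub_card hg
  have h2 := card_filter_sign_add hg
  set P := G.edgeFinset.filter (g · = 1) with hP
  set N := G.edgeFinset.filter (g · = -1) with hN
  set L₁ := L.filter (fun j => IsMuLabel 1 j) with hL₁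
  set L₂ := L.filter (fun j => IsMuLabel 2 j) with hL₂
  obtain ⟨f₁, hf₁⟩ := (P.finite_toSet).exists_bijOn_of_encard_eq
    (t := (L₁ : Set ℤ)) (by
      rw [Set.encard_coe_eq_coe_finsetCard, Set.encard_coe_eq_coe_finsetCard]
      congr 1
      omega)
  obtain ⟨f₂, hf₂⟩ := (N.finite_toSet).exists_bijOn_of_encard_eq
    (t := (L₂ : Set ℤ)) (by
      rw [Set.encard_coe_eq_coe_finsetCard, Set.encard_coe_eq_coe_finsetCard]
      congr 1
      omega)
  have hmod₁ : ∀ j ∈ L₁, j % 3 = 1 := fun j hj => (Finset.mem_filter.mp hj).2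
  have hmod₂ : ∀ j ∈ L₂, j % 3 = 2 := fun j hj => (Finset.mem_filter.mp hj).2
  have hf : ∀ e ∈ G.edgeFinset, (g e = 1 ∧ f₁ e ∈ L₁) ∨ (g e = -1 ∧ f₂ e ∈ L₂) := by
    intro e he
    rcases hg e he with h | h
    · exact Or.inl ⟨h, hf₁.mapsTo (Finset.mem_filter.mpr ⟨he, h⟩)⟩
    · exact Or.inr ⟨h, hf₂.mapsTo (Finset.mem_filter.mpr ⟨he, h⟩)⟩
  refine ⟨fun e => if g e = 1 then f₁ e else f₂ e, ?_, fun e he => ?_⟩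
  · rw [IsLabeling, ← G.coe_edgeFinset]
    refine ⟨fun e he => ?_, fun e he e' he' hee => ?_, fun j hj => ?_⟩
    · rcases hf e he with ⟨h, h'⟩ | ⟨h, h'⟩
      · simpa [h] using Finset.mem_of_mem_filter _ h'
      · simpa [h] using Finset.mem_of_mem_filter _ h'
    · have hc := hf e he
      have hc' := hf e' he'
      rw [Finset.mem_coe] at he he'
      rcases hc with ⟨h, h'⟩ | ⟨h, h'⟩ <;> rcases hc' with ⟨k, k'⟩ | ⟨k, k'⟩
      · simp only [h, k, if_true] at hee
        exact hf₁.injOn (Finset.mem_filter.mpr ⟨he, h⟩) (Finset.mem_filter.mpr ⟨he', k⟩) hee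
      · simp [h, k] at hee
        have := hmod₁ _ h'
        have := hmod₂ _ k'
        omega
      · simp [h, k] at hee
        have := hmod₂ _ h'
        have := hmod₁ _ k'
        omega
      · simp [h, k] at hee
        exact hf₂.injOn (Finset.mem_filter.mpr ⟨he, h⟩) (Finset.mem_filter.mpr ⟨he', k⟩) hee
    · rcases hL j hj with h | h
      · obtain ⟨e, he, rfl⟩ := hf₁.surjOn (by simpa [hL₁, h] using hj : j ∈ (L₁ : Set ℤ))
        have he' := Finset.mem_filter.mp he
        exact ⟨e, he'.1, by simp [he'.2]⟩
      · obtain ⟨e, he, rfl⟩ := hf₂.surjOn (by simpa [hL₂, h] using hj : j ∈ (L₂ : Set ℤ))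
        have he' := Finset.mem_filter.mp he
        exact ⟨e, he'.1, by simp [he'.2]⟩
  · rcases hf e he with ⟨h, h'⟩ | ⟨h, h'⟩
    · simpa [h] using hmod₁ _ h'
    · simpa [h] using hmod₂ _ h'

theorem vertexSum_emod_three {f g : Sym2 V → ℤ}
    (hfg : ∀ e ∈ G.edgeFinset, (g e = 1 ∧ f e % 3 = 1) ∨ (g e = -1 ∧ f e % 3 = 2)) (v : V) :
    vertexSum G f v % 3 = vertexSum G g v % 3 := by
  change vertexSum G f v ≡ vertexSum G g v [ZMOD 3]
  refine Int.ModEq.sum fun e he => ?_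
  rcases hfg e (G.incidenceFinset_subset v he) with ⟨h1, h2⟩ | ⟨h1, h2⟩ <;>
    simp [Int.ModEq, h1, h2]

theorem labelCount_sub_labelCount {f g : Sym2 V → ℤ}
    (hfg : ∀ e ∈ G.edgeFinset, (g e = 1 ∧ f e % 3 = 1) ∨ (g e = -1 ∧ f e % 3 = 2)) (v : V) :
    (labelCount G f 1 v : ℤ) - labelCount G f 2 v = vertexSum G g v := by
  unfold labelCount vertexSum
  simp only [Finset.card_filter, Nat.cast_sum]
  rw [← Finset.sum_sub_distrib]
  refine Finset.sum_congr rfl fun e he => ?_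
  rcases hfg e (G.incidenceFinset_subset v he) with ⟨h1, h2⟩ | ⟨h1, h2⟩ <;>
    simp [IsMuLabel, Int.ModEq, h1, h2]

end Bipartite

theorem lemma2p5 {V : Type*} [Fintype V] [DecidableEq V] [Nonempty V]
    (G : SimpleGraph V) [DecidableRel G.Adj] (X Y : Finset V)
    (hXY : X ∪ Y = Finset.univ)
    (hbip : G.IsBipartiteWith (X : Set V) (Y : Set V))
    (hiso : ∀ v : V, G.degree v ≠ 0)
    (heul : ∀ C : G.ConnectedComponent, ¬ IsEulerianGraph C.toSimpleGraph)
    (hodd : (∀ y ∈ Y, Even (G.degree y)) ∨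
      ∃ C : G.ConnectedComponent,
        (∃ x ∈ X, x ∈ C.supp ∧ Odd (G.degree x)) ∧
        (∃ y ∈ Y, y ∈ C.supp ∧ Odd (G.degree y)))
    (L : Finset ℤ) (l₁ l₂ : ℕ)
    (hL : ∀ j ∈ L, IsMuLabel 1 j ∨ IsMuLabel 2 j)
    (hl₁ : (L.filter (fun j => IsMuLabel 1 j)).card = l₁)
    (hl₂ : (L.filter (fun j => IsMuLabel 2 j)).card = l₂)
    (hsum : l₁ + l₂ = G.edgeFinset.card)
    (hdiff : |(l₁ : ℤ) - (l₂ : ℤ)| ≤ 2) :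
    ∃ f : Sym2 V → ℤ, IsLabeling G L f ∧
      -- (i)
      (∀ x ∈ X, IsMuLabel 1 (vertexSum G f x) ∨ IsMuLabel 2 (vertexSum G f x)) ∧
      -- (ii)
      ((∀ y ∈ Y, Even (G.degree y)) →
        (∀ y ∈ Y, labelCount G f 1 y = labelCount G f 2 y) ∨
        ∃ y' ∈ Y, |(labelCount G f 1 y' : ℤ) - (labelCount G f 2 y' : ℤ)| = 2 ∧
          ∀ y ∈ Y, y ≠ y' → labelCount G f 1 y = labelCount G f 2 y) ∧
      ((∃ y ∈ Y, Odd (G.degree y)) →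
        ∀ y ∈ Y, |(labelCount G f 1 y : ℤ) - (labelCount G f 2 y : ℤ)| ≤ 1) ∧
      -- (iii)
      ((restIn G Y).card ≤ 1 →
        (Fintype.card V : ℚ) / 2 ≤ ((evenIn G Y ∪ restIn G Y).card : ℚ) →
        (∀ y ∈ evenIn G Y ∪ restIn G Y, 4 ≤ G.degree y) →
        (∃ v ∈ X ∪ pendantIn G Y, IsMuLabel 1 (vertexSum G f v)) ∧
        (∃ v ∈ X ∪ pendantIn G Y, IsMuLabel 2 (vertexSum G f v))) := by
  have hdisj : Disjoint X Y := by exact_mod_cast hbip.disjoint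
  obtain ⟨g₀, hg₀⟩ := exists_isGoodSigning hXY hbip hiso heul hodd hdiff (by omega)
  obtain ⟨g, hg, hboth⟩ : ∃ g, IsGoodSigning G X Y ((l₁ : ℤ) - l₂) g ∧
      ((Fintype.card V : ℚ) / 2 ≤ ((evenIn G Y ∪ restIn G Y).card : ℚ) →
        (∀ y ∈ evenIn G Y ∪ restIn G Y, 4 ≤ G.degree y) →
        (∃ x ∈ X, vertexSum G g x % 3 = 1) ∧ ∃ x ∈ X, vertexSum G g x % 3 = 2) := by
    by_cases hcond : (Fintype.card V : ℚ) / 2 ≤ ((evenIn G Y ∪ restIn G Y).card : ℚ) ∧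
        ∀ y ∈ evenIn G Y ∪ restIn G Y, 4 ≤ G.degree y
    · set B := evenIn G Y ∪ restIn G Y with hB
      have hBY : B ⊆ Y :=
        Finset.union_subset (Finset.filter_subset _ _) Finset.sdiff_subset
      have hV : Fintype.card V ≤ 2 * B.card := by
        have := (div_le_iff₀ (by norm_num)).mp hcond.1
        exact_mod_cast this.trans_eq (mul_comm _ _)
      have hVpos : 0 < Fintype.card V := Fintype.card_pos
      have hXB : X.card + B.card ≤ Fintype.card V := by
        rw [← Finset.card_union_of_disjoint (hdisj.mono_right hBY)]
        exact Finset.card_le_univ _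
      obtain ⟨g, hg, h⟩ := hg₀.exists_both_residues hbip hBY
        (Finset.card_pos.mp (by omega)) (by omega) hcond.2
      exact ⟨g, hg, fun _ _ => h⟩
    · exact ⟨g₀, hg₀, fun h h' => absurd ⟨h, h'⟩ hcond⟩
  subst hl₁ hl₂
  obtain ⟨f, hf, hfg⟩ := exists_labeling_of_sign hg.sign hL hsum hg.sum_eq
  have hmod := vertexSum_emod_three hfg
  have hcount := labelCount_sub_labelCount hfg
  refine ⟨f, hf, fun x hx => ?_, fun heven => ?_, fun hoddY y hy => ?_, fun _ hcard hdeg => ?_⟩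
  · have h3 := hg.left x hx
    have := hmod x
    simp only [IsMuLabel, Int.ModEq]
    omega
  · obtain ⟨y', hy', h2, h0⟩ := hg.right_even heven
    have h0' : ∀ y ∈ Y, y ≠ y' → labelCount G f 1 y = labelCount G f 2 y := by
      intro y hy hne
      have := hcount y
      rw [h0 y hy hne] at this
      omega
    rcases h2 with h2 | h2
    · left
      intro y hy
      by_cases hne : y = y'
      · subst hne
        have := hcount y
        omega
      · exact h0' y hy hne
    · exact Or.inr ⟨y', hy', by rw [hcount, h2], h0'⟩
  · rw [hcount]
    exact hg.right_odd hoddY y hy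
  · obtain ⟨⟨x, hx, hx1⟩, x', hx', hx2⟩ := hboth hcard hdeg
    exact ⟨⟨x, Finset.mem_union_left _ hx, (hmod x).trans hx1⟩,
      x', Finset.mem_union_left _ hx', (hmod x').trans hx2⟩
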